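/- Let $P_0\in\mathbb{R}$, $r_0>0$, $\delta\ge 0$ and $0<\varepsilon_1\le\varepsilon_2$ be real numbers. Then there is a constant $K_0$, depending only on $P_0,r_0,\delta,\varepsilon_1,\varepsilon_2$, such that for every $\delta$-hyperbolic GCB-space $(X,\sigma)$ that is $P_0$-packed at scale $r_0$, and every non-elliptic $\sigma$-invariant isometry $g$ of $X$ (an isometry of $X$ onto itself) with $\mathcal{M}_{\varepsilon_1}(g)\neq\emptyset$, $$\sup_{x\in \mathcal{M}_{\varepsilon_2}(g)} d\bigl(x,\mathcal{M}_{\varepsilon_1}(g)\bigr)\le K_0 .$$ Here the following definitions are used. - A *geodesic bicombing* on a metric space $X$ is a map $\sigma\colon X\times X\times[0,1]\to X$, $\sigma_{xy}(t)=\sigma(x,y,t)$, with $\sigma_{xy}(0)=x$, $\sigma_{xy}(1)=y$ and $d(\sigma_{xy}(t),\sigma_{xy}(t'))=|t-t'|\,d(x,y)$ for all $x,y\in X$ and $t,t'\in[0,1]$. It is *convex* if $t\mapsto d(\sigma_{xy}(t),\sigma_{x'y'}(t))$ is convex on $[0,1]$ for all $x,y,x',y'$; *consistent* if $\sigma_{pq}(\lambda)=\sigma_{xy}((1-\lambda)s+\lambda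 t)$ whenever $0\le s\le t\le 1$, $\lambda\in[0,1]$, $p=\sigma_{xy}(s)$, $q=\sigma_{xy}(t)$; *reversible* if $\sigma_{xy}(t)=\sigma_{yx}(1-t)$. A geodesic segment or line $\gamma$ (an isometric embedding of a compact interval or of $\mathbb{R}$) is a *$\sigma$-geodesic* if for all points $x,y$ on it, $\sigma_{xy}$ parametrizes the subsegment of $\gamma$ from $x$ to $y$; $\sigma$ is *geodesically complete* if every nondegenerate $\sigma$-geodesic segment is contained in a $\sigma$-geodesic line. A *GCB-space* is a complete metric space $X$ with a geodesically complete, convex, consistent, reversible geodesic bicombing $\sigma$. - $X$ is *$\delta$-hyperbolic* if $(x,z)_w\ge\min\{(x,y)_w,(y,z)_w\}-\delta$ for all $x,y,z,w\in X$, where $(y,z)_x=\frac12\bigl(d(x,y)+d(x,z)-d(y,z)\bigr)$. - $X$ is *$P_0$-packed at scale $r_0$* if, for every $x\in X$, every subset of the closed ball $\overline B(x,3r_0)$ whose distinct points are at distance $>2r_0$ has at most $P_0$ elements. - An isometry $g$ is *$\sigma$-invariant* if $\sigma_{g(x)g(y)}=g\circ\sigma_{xy}$ for all $x,y\in X$;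 it is *elliptic* if its orbits $\{g^n x: n\in\mathbb{Z}\}$ are bounded. - The *generalized Margulis domain* is $\mathcal{M}_\varepsilon(g)=\bigcup_{i\in\mathbb{Z}\setminus\{0\}}\{x\in X: d(x,g^i x)\le\varepsilon\}$. -/

import Mathlib

open Set

namespace MargulisDomain

variable {X : Type*} [MetricSpace X]

/-- `σ` is a geodesic bicombing on `X`: each `σ x y`, restricted to `[0,1]`, is a geodesic from
`x` to `y` parametrized proportionally to arc length. Only the values `σ x y t` with
`t ∈ [0,1]` are meaningful; every condition below concerns these values only. -/
structure IsGeodesicBicombing (σ : X → X → ℝ → X) : Prop where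
  map_zero : ∀ x y, σ x y 0 = x
  map_one : ∀ x y, σ x y 1 = y
  dist_eq : ∀ x y, ∀ t ∈ Icc (0 : ℝ) 1, ∀ t' ∈ Icc (0 : ℝ) 1,
    dist (σ x y t) (σ x y t') = |t - t'| * dist x y

/-- The bicombing is convex. -/
def IsConvexBicombing (σ : X → X → ℝ → X) : Prop :=
  ∀ x y x' y', ConvexOn ℝ (Icc (0 : ℝ) 1) (fun t => dist (σ x y t) (σ x' y' t))

/-- The bicombing is consistent. -/
def IsConsistent (σ : X → X → ℝ → X) : Prop :=
  ∀ x y, ∀ s t : ℝ, 0 ≤ s → s ≤ t → t ≤ 1 → ∀ l ∈ Icc (0 : ℝ) 1,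
    σ (σ x y s) (σ x y t) l = σ x y ((1 - l) * s + l * t)

/-- The bicombing is reversible. -/
def IsReversible (σ : X → X → ℝ → X) : Prop :=
  ∀ x y, ∀ t ∈ Icc (0 : ℝ) 1, σ x y t = σ y x (1 - t)

/-- `γ`, restricted to the interval `I`, is a `σ`-geodesic: it is an isometric embedding of `I`
and, for any two points `γ s`, `γ t` on it, `σ (γ s) (γ t)` is the (affine) parametrization of the
portion of `γ` between them. -/
def IsSigmaGeodesicOn (σ : X → X → ℝ → X) (γ : ℝ → X) (I : Set ℝ) : Prop :=
  (∀ s ∈ I, ∀ t ∈ I, dist (γ s) (γ t) = |s - t|) ∧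
  ∀ s ∈ I, ∀ t ∈ I, ∀ l ∈ Icc (0 : ℝ) 1, σ (γ s) (γ t) l = γ ((1 - l) * s + l * t)

/-- Geodesic completeness: every (nondegenerate) `σ`-geodesic segment is contained in a
`σ`-geodesic line. -/
def IsGeodesicallyComplete (σ : X → X → ℝ → X) : Prop :=
  ∀ (a b : ℝ) (γ : ℝ → X), a < b → IsSigmaGeodesicOn σ γ (Icc a b) →
    ∃ η : ℝ → X, IsSigmaGeodesicOn σ η univ ∧ γ '' Icc a b ⊆ range η

/-- `σ` is a GCB: a geodesically complete, convex, consistent, reversible geodesic bicombing.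
A GCB-space is a complete metric space together with a GCB. -/
structure IsGCB (σ : X → X → ℝ → X) : Prop where
  bicombing : IsGeodesicBicombing σ
  convex : IsConvexBicombing σ
  consistent : IsConsistent σ
  reversible : IsReversible σ
  complete : IsGeodesicallyComplete σ

/-- `X` is `P₀`-packed at scale `r₀`: in every closed ball of radius `3 r₀`, the largest
cardinality of a subset whose distinct points are at distance `> 2 r₀` is at most `P₀`. -/
def IsPacked (X : Type*) [MetricSpace X] (P₀ r₀ : ℝ) : Prop :=
  ∀ x : X, (Metric.packingNumber (2 * r₀).toNNReal (Metric.closedBall x (3 * r₀)) : ENNReal)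
    ≤ ENNReal.ofReal P₀

/-- The Gromov product `(y, z)_x`. -/
noncomputable def gromovProduct (x y z : X) : ℝ := (dist x y + dist x z - dist y z) / 2

/-- `δ`-hyperbolicity, through the four-point condition. -/
def IsHyperbolic (X : Type*) [MetricSpace X] (δ : ℝ) : Prop :=
  ∀ x y z w : X,
    min (gromovProduct w x y) (gromovProduct w y z) - δ ≤ gromovProduct w x z

/-- `g` is a `σ`-isometry: it maps the curve `σ x y` to the curve `σ (g x) (g y)`. -/
def IsSigmaIsometry (σ : X → X → ℝ → X) (g : X ≃ᵢ X) : Prop :=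
  ∀ x y, ∀ t ∈ Icc (0 : ℝ) 1, σ (g x) (g y) t = g (σ x y t)

/-- `g` is elliptic: its orbits are bounded. -/
def IsElliptic (g : X ≃ᵢ X) : Prop :=
  ∀ x, Bornology.IsBounded (range fun n : ℤ => (g ^ n) x)

/-- The Margulis domain `M_ε(g)`. -/
def margulisDomain (ε : ℝ) (g : X ≃ᵢ X) : Set X := {x | dist x (g x) ≤ ε}

/-- The generalized Margulis domain: the union of the Margulis domains of the powers `g ^ i`,
`i` a nonzero integer. -/
def genMargulisDomain (ε : ℝ) (g : X ≃ᵢ X) : Set X :=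
  ⋃ i ∈ {i : ℤ | i ≠ 0}, margulisDomain ε (g ^ i)

end MargulisDomain

/-! Let `x` be moved at most `ε₂` by `g ^ i`, where `i > 0`. Packing passes to all scales
(`exists_separatedCardLE`) and gives a uniform bound `N` on `ε₁`-separated subsets of balls of
radius `1 + 4 * δ`. Compare the minimal displacement of `g ^ i` with `1 / (N + 1)`. If it is
smaller, some `w` is moved at most `1` by every `(g ^ i) ^ k`, `k ≤ N`. By hyperbolicity, a point
`y` within `N * ε₂` of `x`, on the geodesic towards `w` or equal to `w`, is moved at most `1 + 4 *
δ` by these powers. Two of the `N + 1` orbit points of `y` are then `ε₁`-close, so a power of `g`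
moves `y` at most `ε₁`. Otherwise minimal displacement grows linearly in powers
(`IsGCB.mul_minDisplacement_le`), so `u = (g ^ i) ^ k`, with `k` uniform, moves every point more
than `1 + 6 * δ`. Take `w` in the `ε₁`-domain, almost minimal for `g` and almost nearest to `x` in
its `u`-orbit. If `x` and `w` were far apart, `u` would move the midpoint between them too little.
-/

namespace MargulisDomain

/-! ### Packing bounds at all scales -/

section Packing

variable {X : Type*} [MetricSpace X]

/-- `A` has at most `N` points at pairwise distance greater than `r`. -/
def SeparatedCardLE (r : ℝ) (A : Set X) (N : ℕ) : Prop :=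
  ∀ s : Finset X, (s : Set X) ⊆ A → (∀ a ∈ s, ∀ b ∈ s, a ≠ b → r < dist a b) → s.card ≤ N

lemma IsPacked.separatedCardLE {P₀ r₀ : ℝ} (hr₀ : 0 < r₀) (h : IsPacked X P₀ r₀) (x : X) :
    SeparatedCardLE (2 * r₀) (Metric.closedBall x (3 * r₀)) ⌊P₀⌋₊ := by
  intro s hs hsep
  have h1 : Metric.IsSeparated ((2 * r₀).toNNReal : ENNReal) (s : Set X) := by
    intro a ha b hb hab
    rw [edist_dist]
    exact (ENNReal.ofReal_lt_ofReal_iff_of_nonneg (by positivity)).2 (hsep a ha b hb hab)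
  have h2 := h1.encard_le_packingNumber hs
  have h3 : ((s.card : ℕ∞) : ENNReal) ≤ ENNReal.ofReal P₀ := by
    rw [← Set.encard_coe_eq_coe_finsetCard]
    exact le_trans (by exact_mod_cast h2) (h x)
  rw [ENat.toENNReal_coe] at h3
  rcases Nat.eq_zero_or_pos s.card with h0 | h0
  · omega
  · apply Nat.le_floor
    rw [← ENNReal.ofReal_natCast, ENNReal.ofReal_le_ofReal_iff'] at h3
    refine h3.resolve_right fun h4 => ?_
    have : s.card ≤ 0 := by exact_mod_cast h4
    omega

/-- A maximal separated set is a net. -/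
lemma SeparatedCardLE.exists_net {r : ℝ} {A : Set X} {N : ℕ} (h : SeparatedCardLE r A N) :
    ∃ t : Finset X, t.card ≤ N ∧ ∀ z ∈ A, ∃ c ∈ t, dist z c ≤ r ∨ z = c := by
  classical
  let Q : ℕ → Prop := fun n => ∃ s : Finset X, (s : Set X) ⊆ A ∧
    (∀ a ∈ s, ∀ b ∈ s, a ≠ b → r < dist a b) ∧ s.card = n
  have hQ0 : Q 0 := ⟨∅, by simp, by simp, by simp⟩
  have hQ : Q (Nat.findGreatest Q N) := Nat.findGreatest_spec (Nat.zero_le N) hQ0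
  obtain ⟨s, hsA, hsep, hcard⟩ := hQ
  refine ⟨s, h s hsA hsep, fun z hz => ?_⟩
  by_contra! hfar
  have hzs : z ∉ s := fun hzs => (hfar z hzs).2 rfl
  have hsep' : ∀ a ∈ insert z s, ∀ b ∈ insert z s, a ≠ b → r < dist a b := by
    intro a ha b hb hab
    rw [Finset.mem_insert] at ha hb
    rcases ha with rfl | ha <;> rcases hb with rfl | hb
    · exact absurd rfl hab
    · exact (hfar b hb).1
    · rw [dist_comm]; exact (hfar a ha).1
    · exact hsep a ha b hb hab
  have hA' : ((insert z s : Finset X) : Set X) ⊆ A := by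
    rw [Finset.coe_insert]; exact Set.insert_subset hz hsA
  have hle := h _ hA' hsep'
  have hge : s.card + 1 ≤ Nat.findGreatest Q N :=
    Nat.le_findGreatest (by rwa [Finset.card_insert_of_notMem hzs] at hle)
      ⟨_, hA', hsep', Finset.card_insert_of_notMem hzs⟩
  omega

variable {σ : X → X → ℝ → X}

lemma IsGeodesicBicombing.dist_left (hσ : IsGeodesicBicombing σ) (x y : X) {t : ℝ}
    (ht : t ∈ Icc (0 : ℝ) 1) : dist x (σ x y t) = t * dist x y := by
  have h := hσ.dist_eq x y 0 (by simp) t ht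
  rwa [hσ.map_zero, zero_sub, abs_neg, abs_of_nonneg ht.1] at h

lemma IsGeodesicBicombing.dist_right (hσ : IsGeodesicBicombing σ) (x y : X) {t : ℝ}
    (ht : t ∈ Icc (0 : ℝ) 1) : dist (σ x y t) y = (1 - t) * dist x y := by
  have h := hσ.dist_eq x y t ht 1 (by simp)
  rwa [hσ.map_one, abs_sub_comm, abs_of_nonneg (by linarith [ht.2])] at h

lemma IsGeodesicBicombing.exists_dist_le (hσ : IsGeodesicBicombing σ) {x z : X} {R r : ℝ}
    (hR : 0 < R) (hr : 0 ≤ r) (h : dist z x ≤ R + r) :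
    ∃ z', dist z z' ≤ r ∧ dist z' x ≤ R := by
  rcases le_or_gt (dist z x) R with hle | hlt
  · exact ⟨z, by simpa using hr, hle⟩
  · have hd : 0 < dist z x := hR.trans hlt
    have ht : 1 - R / dist z x ∈ Icc (0 : ℝ) 1 :=
      ⟨by rw [sub_nonneg, div_le_one hd]; exact hlt.le, by linarith [div_nonneg hR.le hd.le]⟩
    refine ⟨σ z x (1 - R / dist z x), ?_, ?_⟩
    · rw [hσ.dist_left z x ht, sub_mul, div_mul_cancel₀ _ hd.ne']
      linarith
    · rw [hσ.dist_right z x ht, sub_sub_cancel, div_mul_cancel₀ _ hd.ne']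

/-- Balls of arbitrary radius are covered by a controlled number of balls of radius `3 r`. -/
lemma exists_cover_of_separatedCardLE (hσ : IsGeodesicBicombing σ) {r : ℝ} (hr : 0 < r) {N : ℕ}
    (h : ∀ x : X, SeparatedCardLE (2 * r) (Metric.closedBall x (3 * r)) N) (n : ℕ) (x : X) :
    ∃ t : Finset X, t.card ≤ N ^ n ∧
      ∀ z ∈ Metric.closedBall x (3 * r + n * r), ∃ c ∈ t, dist z c ≤ 3 * r := by
  classical
  induction n with
  | zero => exact ⟨{x}, by simp, fun z hz => ⟨x, by simp, by simpa using hz⟩⟩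
  | succ n ih =>
    obtain ⟨t, ht, hcov⟩ := ih
    choose net hnet hnetcov using fun c : X => (h c).exists_net
    refine ⟨t.biUnion net, ?_, fun z hz => ?_⟩
    · calc (t.biUnion net).card ≤ t.card * N :=
            Finset.card_biUnion_le_card_mul _ _ _ fun c _ => hnet c
        _ ≤ N ^ (n + 1) := by rw [pow_succ]; gcongr
    · rw [Metric.mem_closedBall] at hz
      push_cast at hz
      obtain ⟨z', hzz', hz'⟩ := hσ.exists_dist_le (R := 3 * r + n * r) (r := r) (by positivity)
        hr.le (by linarith : dist z x ≤ _)
      obtain ⟨c, hc, hzc⟩ := hcov z' hz'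
      obtain ⟨c', hc', hzc'⟩ := hnetcov c z' hzc
      -- The net costs `2 * r` and the step from `z` to `z'` costs `r`, so the covering radius stays
      -- `3 * r`.
      refine ⟨c', Finset.mem_biUnion.2 ⟨c, hc, hc'⟩, ?_⟩
      have hle : dist z' c' ≤ 2 * r := by
        rcases hzc' with h1 | rfl
        · exact h1
        · rw [dist_self]; positivity
      linarith [dist_triangle z z' c']

lemma separatedCardLE_of_large_radius (hσ : IsGeodesicBicombing σ) {r : ℝ} (hr : 0 < r) {N : ℕ}
    (h : ∀ x : X, SeparatedCardLE (2 * r) (Metric.closedBall x (3 * r)) N) (n : ℕ) (x : X) :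
    SeparatedCardLE (2 * r) (Metric.closedBall x (3 * r + n * r)) (N ^ n * N) := by
  classical
  obtain ⟨t, ht, hcov⟩ := exists_cover_of_separatedCardLE hσ hr h n x
  intro s hs hsep
  have hsub : s ⊆ t.biUnion fun c => s.filter fun z => dist z c ≤ 3 * r := by
    intro z hz
    obtain ⟨c, hc, hzc⟩ := hcov z (hs hz)
    exact Finset.mem_biUnion.2 ⟨c, hc, Finset.mem_filter.2 ⟨hz, hzc⟩⟩
  calc s.card ≤ _ := Finset.card_le_card hsub
    _ ≤ t.card * N := Finset.card_biUnion_le_card_mul _ _ _ fun c _ =>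
        h c _ (fun z hz => (Finset.mem_filter.1 hz).2) fun a ha b hb hab =>
          hsep a (Finset.mem_filter.1 ha).1 b (Finset.mem_filter.1 hb).1 hab
    _ ≤ N ^ n * N := by gcongr

/-- The unit speed parametrization of a bicombing geodesic is a `σ`-geodesic. -/
lemma IsGCB.isSigmaGeodesicOn (hσ : IsGCB σ) {y p : X} (hyp : y ≠ p) :
    IsSigmaGeodesicOn σ (fun s => σ y p (s / dist y p)) (Icc 0 (dist y p)) := by
  have hd : 0 < dist y p := dist_pos.2 hyp
  have hmem : ∀ s ∈ Icc 0 (dist y p), s / dist y p ∈ Icc (0 : ℝ) 1 := fun s hs =>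
    ⟨div_nonneg hs.1 hd.le, (div_le_one hd).2 hs.2⟩
  have hfwd : ∀ s ∈ Icc 0 (dist y p), ∀ t ∈ Icc 0 (dist y p), s ≤ t → ∀ l ∈ Icc (0 : ℝ) 1,
      σ (σ y p (s / dist y p)) (σ y p (t / dist y p)) l
        = σ y p (((1 - l) * s + l * t) / dist y p) := by
    intro s hs t ht hst l hl
    rw [hσ.consistent y p _ _ (hmem s hs).1 (by gcongr) (hmem t ht).2 l hl]
    congr 1
    ring
  refine ⟨fun s hs t ht => ?_, fun s hs t ht l hl => ?_⟩
  · change dist (σ y p (s / dist y p)) (σ y p (t / dist y p)) = _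
    rw [hσ.bicombing.dist_eq y p _ (hmem s hs) _ (hmem t ht), ← sub_div, abs_div,
      abs_of_pos hd, div_mul_cancel₀ _ hd.ne']
  · rcases le_total s t with hst | hst
    · exact hfwd s hs t ht hst l hl
    · change σ (σ y p (s / dist y p)) (σ y p (t / dist y p)) l = _
      rw [hσ.reversible _ _ l hl, hfwd t ht s hs hst _ ⟨by linarith [hl.2], by linarith [hl.1]⟩]
      congr 1
      ring

/-- Contractions towards a point along the bicombing are surjective. -/
lemma IsGCB.exists_extension (hσ : IsGCB σ) (y p : X) {t : ℝ} (ht0 : 0 < t) (ht1 : t ≤ 1) :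
    ∃ q, σ y q t = p ∧ t * dist y q = dist y p := by
  suffices h : ∃ q, σ y q t = p by
    obtain ⟨q, hq⟩ := h
    exact ⟨q, hq, by rw [← hσ.bicombing.dist_left y q ⟨ht0.le, ht1⟩, hq]⟩
  by_cases hyp : y = p
  · subst hyp
    refine ⟨y, ?_⟩
    have h := hσ.bicombing.dist_left y y (t := t) ⟨ht0.le, ht1⟩
    rw [dist_self, mul_zero] at h
    exact (dist_eq_zero.1 h).symm
  · have hd : 0 < dist y p := dist_pos.2 hyp
    obtain ⟨η, hη, hsub⟩ := hσ.complete 0 (dist y p) _ hd (hσ.isSigmaGeodesicOn hyp)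
    obtain ⟨s₀, hs₀⟩ := hsub ⟨0, ⟨le_rfl, hd.le⟩, rfl⟩
    obtain ⟨s₁, hs₁⟩ := hsub ⟨dist y p, ⟨hd.le, le_rfl⟩, rfl⟩
    simp only [zero_div, div_self hd.ne', hσ.bicombing.map_zero, hσ.bicombing.map_one] at hs₀ hs₁
    -- The line may run from `y` to `p` in either direction; the signed difference `s₁ - s₀` covers
    -- both.
    refine ⟨η (s₀ + (s₁ - s₀) / t), ?_⟩
    have h := hη.2 s₀ (mem_univ _) (s₀ + (s₁ - s₀) / t) (mem_univ _) t ⟨ht0.le, ht1⟩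
    rw [hs₀] at h
    rw [h, ← hs₁]
    congr 1
    field_simp
    ring

lemma IsGCB.dist_contract_le (hσ : IsGCB σ) (y p q : X) {t : ℝ} (ht : t ∈ Icc (0 : ℝ) 1) :
    dist (σ y p t) (σ y q t) ≤ t * dist p q := by
  have hconv : ConvexOn ℝ (Icc (0 : ℝ) 1) fun t => dist (σ y p t) (σ y q t) :=
    hσ.convex y p y q
  have h := hconv.2 (left_mem_Icc.2 zero_le_one) (right_mem_Icc.2 zero_le_one)
    (sub_nonneg.2 ht.2) ht.1 (sub_add_cancel 1 t)
  simpa [hσ.bicombing.map_zero, hσ.bicombing.map_one] using h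

/-- Geodesic completeness transfers packing bounds from large scales to small scales. -/
lemma IsGCB.separatedCardLE_contract (hσ : IsGCB σ) {y : X} {r R t : ℝ} {N : ℕ} (ht0 : 0 < t)
    (ht1 : t ≤ 1) (h : SeparatedCardLE r (Metric.closedBall y R) N) :
    SeparatedCardLE (t * r) (Metric.closedBall y (t * R)) N := by
  classical
  choose f hf hfd using fun p => hσ.exists_extension y p ht0 ht1
  intro s hs hsep
  have hfinj : Function.Injective f := fun a b hab => by rw [← hf a, ← hf b, hab]
  rw [← Finset.card_image_of_injective s hfinj]
  refine h _ ?_ ?_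
  · intro z hz
    obtain ⟨p, hp, rfl⟩ := Finset.mem_image.1 (Finset.mem_coe.1 hz)
    have h1 : dist p y ≤ t * R := hs hp
    rw [dist_comm, ← hfd p] at h1
    rw [Metric.mem_closedBall, dist_comm]
    exact le_of_mul_le_mul_left h1 ht0
  · intro a ha b hb hab
    obtain ⟨p, hp, rfl⟩ := Finset.mem_image.1 ha
    obtain ⟨q, hq, rfl⟩ := Finset.mem_image.1 hb
    have h1 := hsep p hp q hq fun hpq => hab (by rw [hpq])
    have h2 := hσ.dist_contract_le y (f p) (f q) ⟨ht0.le, ht1⟩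
    rw [hf p, hf q] at h2
    exact lt_of_mul_lt_mul_left (h1.trans_le h2) ht0.le

end Packing

/-- In a packed GCB-space, packing bounds hold at all scales, uniformly over all such spaces. -/
lemma exists_separatedCardLE (P₀ r₀ ε C : ℝ) (hr₀ : 0 < r₀) (hε : 0 < ε) :
    ∃ N : ℕ, ∀ (X : Type*) [MetricSpace X] (σ : X → X → ℝ → X), IsGCB σ → IsPacked X P₀ r₀ →
      ∀ y : X, SeparatedCardLE ε (Metric.closedBall y C) N := by
  obtain ⟨t, ht0, ht1, htε⟩ : ∃ t : ℝ, 0 < t ∧ t ≤ 1 ∧ t * (2 * r₀) ≤ ε := by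
    refine ⟨min 1 (ε / (2 * r₀)), lt_min one_pos (by positivity), min_le_left _ _, ?_⟩
    calc _ ≤ ε / (2 * r₀) * (2 * r₀) := by gcongr; exact min_le_right _ _
      _ = ε := by field_simp
  -- The factor `t` shrinks the separation `2 * r₀` to at most `ε`; `n` is large enough that the
  -- shrunken big ball still contains the ball of radius `C`.
  obtain ⟨n, hn⟩ := exists_nat_ge (C / (t * r₀))
  refine ⟨⌊P₀⌋₊ ^ n * ⌊P₀⌋₊, fun X _ σ hσ hX y s hs hsep => ?_⟩
  refine hσ.separatedCardLE_contract ht0 ht1 (separatedCardLE_of_large_radius hσ.bicombing hr₀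
    (fun x => hX.separatedCardLE hr₀ x) n y) s (hs.trans (Metric.closedBall_subset_closedBall ?_))
    fun a ha b hb hab => htε.trans_lt (hsep a ha b hb hab)
  rw [div_le_iff₀ (by positivity)] at hn
  nlinarith [mul_pos ht0 hr₀]

end MargulisDomain

namespace MargulisDomain

/-! ### Minimal displacement of powers -/

section Displacement

variable {X : Type*} [MetricSpace X] {σ : X → X → ℝ → X}

lemma IsSigmaIsometry.mul {g h : X ≃ᵢ X} (hg : IsSigmaIsometry σ g) (hh : IsSigmaIsometry σ h) :
    IsSigmaIsometry σ (g * h) := fun x y t ht => by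
  rw [IsometryEquiv.mul_apply, IsometryEquiv.mul_apply, IsometryEquiv.mul_apply, hg _ _ t ht,
    hh _ _ t ht]

lemma IsSigmaIsometry.pow {g : X ≃ᵢ X} (hg : IsSigmaIsometry σ g) (n : ℕ) :
    IsSigmaIsometry σ (g ^ n) := by
  induction n with
  | zero => exact fun x y t _ => rfl
  | succ n ih => rw [pow_succ]; exact ih.mul hg

lemma dist_pow_apply_le (g : X ≃ᵢ X) (x : X) (n : ℕ) :
    dist x ((g ^ n) x) ≤ n * dist x (g x) := by
  induction n with
  | zero => simp
  | succ n ih =>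
    have h1 : dist ((g ^ n) x) ((g ^ (n + 1)) x) = dist x (g x) := by
      rw [pow_succ, IsometryEquiv.mul_apply, (g ^ n).dist_eq]
    have h2 := dist_triangle x ((g ^ n) x) ((g ^ (n + 1)) x)
    push_cast
    linarith

/-- Passing to midpoints halves the displacement of the square. -/
lemma IsGCB.exists_dist_le_half (hσ : IsGCB σ) {g : X ≃ᵢ X} (hg : IsSigmaIsometry σ g) (y : X) :
    ∃ m, dist m (g m) ≤ dist y ((g ^ 2) y) / 2 := by
  have hhalf : (1 / 2 : ℝ) ∈ Icc (0 : ℝ) 1 := by constructor <;> norm_num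
  refine ⟨σ y (g y) (1 / 2), ?_⟩
  have h := hσ.dist_contract_le (g y) y (g (g y)) hhalf
  -- `m` and `g m` are the midpoints of two geodesics issuing from `g y`, towards `y` and towards `g
  -- (g y)`.
  rw [hg _ _ _ hhalf, hσ.reversible (g y) y _ hhalf] at h
  norm_num at h ⊢
  rw [pow_two, IsometryEquiv.mul_apply]
  linarith

/-- The minimal displacement of an isometry. -/
noncomputable def minDisplacement (g : X ≃ᵢ X) : ℝ := ⨅ y, dist y (g y)

lemma minDisplacement_le (g : X ≃ᵢ X) (y : X) : minDisplacement g ≤ dist y (g y) :=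
  ciInf_le ⟨0, by rintro _ ⟨z, rfl⟩; exact dist_nonneg⟩ y

lemma exists_dist_lt_of_minDisplacement_lt [Nonempty X] {g : X ≃ᵢ X} {c : ℝ}
    (h : minDisplacement g < c) : ∃ y, dist y (g y) < c :=
  exists_lt_of_ciInf_lt h

/-- Iterated halving by midpoints: each step replaces `g ^ 2 ^ (n + 1)` by `g ^ 2 ^ n` at another
point. -/
lemma IsGCB.two_pow_mul_minDisplacement_le (hσ : IsGCB σ) (n : ℕ) {g : X ≃ᵢ X}
    (hg : IsSigmaIsometry σ g) (y : X) :
    2 ^ n * minDisplacement g ≤ dist y ((g ^ 2 ^ n) y) := by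
  induction n generalizing y with
  | zero => simpa using minDisplacement_le g y
  | succ n ih =>
    obtain ⟨m, hm⟩ := hσ.exists_dist_le_half (hg.pow (2 ^ n)) y
    rw [← pow_mul, ← pow_succ] at hm
    have h := ih m
    rw [pow_succ]
    linarith

/-- In a GCB-space the minimal displacement equals the stable displacement. -/
lemma IsGCB.mul_minDisplacement_le (hσ : IsGCB σ) {g : X ≃ᵢ X} (hg : IsSigmaIsometry σ g)
    (k : ℕ) (y : X) : k * minDisplacement g ≤ dist y ((g ^ k) y) := by
  rcases Nat.eq_zero_or_pos k with rfl | hk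
  · simp
  have hk' : (0 : ℝ) < k := by exact_mod_cast hk
  by_contra! hlt
  set e := k * minDisplacement g - dist y ((g ^ k) y) with he
  have hepos : 0 < e := by linarith
  -- The deficit `e` accumulates to `2 ^ n * e`, while rounding `2 ^ n` to a multiple of `k` costs
  -- at most `k * k * dist y (g y)`.
  obtain ⟨n, hn⟩ := pow_unbounded_of_one_lt (k * k * dist y (g y) / e) (one_lt_two (α := ℝ))
  rw [div_lt_iff₀ hepos] at hn
  have h1 := hσ.two_pow_mul_minDisplacement_le n hg y
  set q := 2 ^ n / k with hq
  set s := 2 ^ n % k with hs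
  have hdiv : k * q + s = 2 ^ n := Nat.div_add_mod _ _
  have hsk : s < k := Nat.mod_lt _ hk
  have h2 : dist y ((g ^ 2 ^ n) y) ≤ q * dist y ((g ^ k) y) + s * dist y (g y) := by
    rw [← hdiv, pow_add, IsometryEquiv.mul_apply]
    have h3 := dist_triangle y ((g ^ (k * q)) y) ((g ^ (k * q)) ((g ^ s) y))
    rw [(g ^ (k * q)).dist_eq] at h3
    have h4 := dist_pow_apply_le (g ^ k) y q
    rw [← pow_mul] at h4
    linarith [dist_pow_apply_le g y s]
  have hdivR : (k : ℝ) * q + s = 2 ^ n := by exact_mod_cast hdiv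
  have hskR : (s : ℝ) ≤ k := by exact_mod_cast hsk.le
  have hs0 : (0 : ℝ) ≤ s := Nat.cast_nonneg s
  have h5 : (s : ℝ) * dist y (g y) ≤ k * dist y (g y) := by gcongr
  have h6 : (k : ℝ) * q * dist y ((g ^ k) y) ≤ 2 ^ n * dist y ((g ^ k) y) := by
    gcongr; linarith
  have h7 : k * (2 ^ n * minDisplacement g)
      ≤ k * (q * dist y ((g ^ k) y) + k * dist y (g y)) := by gcongr; linarith
  have h8 : (2 : ℝ) ^ n * e
      = k * (2 ^ n * minDisplacement g) - 2 ^ n * dist y ((g ^ k) y) := by rw [he]; ring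
  linarith

lemma exists_pos_of_mem_genMargulisDomain {ε : ℝ} {g : X ≃ᵢ X} {x : X}
    (hx : x ∈ genMargulisDomain ε g) : ∃ n : ℕ, 0 < n ∧ dist x ((g ^ n) x) ≤ ε := by
  simp only [genMargulisDomain, margulisDomain, mem_iUnion, mem_ofPred_eq] at hx
  obtain ⟨i, hi, hx⟩ := hx
  obtain ⟨n, rfl | rfl⟩ := i.eq_nat_or_neg
  · exact ⟨n, by omega, by simpa using hx⟩
  · refine ⟨n, by omega, ?_⟩
    rw [zpow_neg, zpow_natCast] at hx
    rw [← (g ^ n).dist_eq, IsometryEquiv.apply_inv_self, dist_comm] at hx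
    exact hx

lemma mem_genMargulisDomain_of_pow {ε : ℝ} {g : X ≃ᵢ X} {x : X} {n : ℕ} (hn : 0 < n)
    (h : dist x ((g ^ n) x) ≤ ε) : x ∈ genMargulisDomain ε g := by
  simp only [genMargulisDomain, margulisDomain, mem_iUnion, mem_ofPred_eq]
  exact ⟨n, by omega, by simpa using h⟩

/-! ### Hyperbolic estimates and pigeonhole -/

/-- The four-point inequality for sums of distances. -/
lemma IsHyperbolic.four_point {δ : ℝ} (h : IsHyperbolic X δ) (a b c d : X) :
    dist a b + dist c d ≤ max (dist a c + dist b d) (dist a d + dist b c) + 2 * δ := by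
  have h1 := h a c b d
  simp only [gromovProduct] at h1
  rw [dist_comm d a, dist_comm d b, dist_comm d c] at h1
  rw [dist_comm c b] at h1
  rcases le_total (dist a c + dist b d) (dist a d + dist b c) with h2 | h2
  · rw [max_eq_right h2]
    rcases min_le_iff.1 (sub_le_iff_le_add.1 h1) with h3 | h3 <;> linarith
  · rw [max_eq_left h2]
    rcases min_le_iff.1 (sub_le_iff_le_add.1 h1) with h3 | h3 <;> linarith

/-- The distance from a point to a point on a geodesic. -/
lemma IsHyperbolic.dist_geodesic_le {δ L a : ℝ} (h : IsHyperbolic X δ) {p q y : X} (z : X)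
    (hpq : dist p q = L) (hpy : dist p y = a) (hyq : dist y q = L - a) :
    dist y z ≤ max (dist q z - (L - a)) (dist p z - a) + 2 * δ := by
  have h1 := h.four_point y z p q
  rw [dist_comm y p, dist_comm z q, dist_comm z p] at h1
  rcases max_cases (dist p y + dist q z) (dist y q + dist p z) with ⟨h2, _⟩ | ⟨h2, _⟩
  · linarith [le_max_left (dist q z - (L - a)) (dist p z - a)]
  · linarith [le_max_right (dist q z - (L - a)) (dist p z - a)]

/-- Corresponding points on two geodesics of the same length are close, provided that they are
far from the endpoints and that the geodesics are not shifted against each other. -/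
lemma IsHyperbolic.dist_geodesics_le {δ L a C : ℝ} (h : IsHyperbolic X δ) {p q y p' q' y' : X}
    (hpq : dist p q = L) (hpy : dist p y = a) (hyq : dist y q = L - a)
    (hpq' : dist p' q' = L) (hpy' : dist p' y' = a) (hyq' : dist y' q' = L - a)
    (hpp : dist p p' ≤ 2 * a + C) (hqq : dist q q' ≤ 2 * (L - a) + C)
    (hpq1 : dist p q' ≤ L + C) (hqp1 : dist q p' ≤ L + C) :
    dist y y' ≤ C + 4 * δ := by
  -- One loss of `2 * δ` occurs in estimating `y'` from `p` and `q`, another in passing to `y`.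
  have h1 := h.dist_geodesic_le y' hpq hpy hyq
  have h2 := h.dist_geodesic_le q hpq' hpy' hyq'
  have h3 := h.dist_geodesic_le p hpq' hpy' hyq'
  rw [dist_comm y' q, dist_comm q' q, dist_comm p' q] at h2
  rw [dist_comm y' p, dist_comm q' p, dist_comm p' p] at h3
  have h2' : dist q y' ≤ (L - a) + C + 2 * δ :=
    h2.trans (add_le_add_left (max_le (by linarith) (by linarith)) _)
  have h3' : dist p y' ≤ a + C + 2 * δ :=
    h3.trans (add_le_add_left (max_le (by linarith) (by linarith)) _)
  have := h1.trans (add_le_add_left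
    (max_le (c := C + 2 * δ) (by linarith) (by linarith)) (2 * δ))
  linarith

/-- If `x` is moved a little by the powers `g ^ k` with `k ≤ N`, and some other point is moved by
at most `1`, then some point near `x` is moved by at most a constant. -/
lemma IsGCB.exists_dist_le_of_pow (hσ : IsGCB σ) {δ : ℝ} (hδ : 0 ≤ δ) (hX : IsHyperbolic X δ)
    {g : X ≃ᵢ X} {N : ℕ} {D : ℝ} {x w : X}
    (hx : ∀ k ≤ N, dist x ((g ^ k) x) ≤ D) (hw : ∀ k ≤ N, dist w ((g ^ k) w) ≤ 1) :
    ∃ y, dist x y ≤ D ∧ ∀ k ≤ N, dist y ((g ^ k) y) ≤ 1 + 4 * δ := by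
  rcases le_or_gt (dist x w) D with hL | hL
  · exact ⟨w, hL, fun k hk => by linarith [hw k hk]⟩
  have hD : 0 ≤ D := dist_nonneg.trans (hx 0 (Nat.zero_le N))
  have hL0 : 0 < dist x w := hD.trans_lt hL
  have ht : D / dist x w ∈ Icc (0 : ℝ) 1 := ⟨by positivity, (div_le_one hL0).2 hL.le⟩
  set y := σ x w (D / dist x w) with hy
  have hxy : dist x y = D := by
    rw [hy, hσ.bicombing.dist_left x w ht, div_mul_cancel₀ _ hL0.ne']
  have hyw : dist y w = dist x w - D := by
    rw [hy, hσ.bicombing.dist_right x w ht, sub_mul, div_mul_cancel₀ _ hL0.ne', one_mul]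
  refine ⟨y, hxy.le, fun k hk => ?_⟩
  refine hX.dist_geodesics_le (p' := (g ^ k) x) (q' := (g ^ k) w) rfl hxy hyw
    ((g ^ k).dist_eq _ _) (((g ^ k).dist_eq _ _).trans hxy) (((g ^ k).dist_eq _ _).trans hyw)
    ?_ ?_ ?_ ?_
  · linarith [hx k hk]
  · linarith [hw k hk]
  · linarith [dist_triangle x w ((g ^ k) w), hw k hk]
  · have h1 := dist_triangle w ((g ^ k) w) ((g ^ k) x)
    rw [(g ^ k).dist_eq, dist_comm w x] at h1
    linarith [hw k hk]

/-- Pigeonhole: among sufficiently many points of an orbit in a ball, two are close. -/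
lemma exists_dist_pow_le {ε C : ℝ} {N : ℕ} {g : X ≃ᵢ X} {y : X} (hε : 0 ≤ ε)
    (hN : SeparatedCardLE ε (Metric.closedBall y C) N)
    (hy : ∀ k ≤ N, dist y ((g ^ k) y) ≤ C) : ∃ m : ℕ, 0 < m ∧ dist y ((g ^ m) y) ≤ ε := by
  classical
  by_contra! hfar
  have hsep : ∀ k l : ℕ, k ≠ l → ε < dist ((g ^ k) y) ((g ^ l) y) := by
    intro k l hkl
    wlog h : k < l generalizing k l
    · rw [dist_comm]; exact this l k hkl.symm (by omega)
    obtain ⟨m, rfl⟩ := Nat.exists_eq_add_of_lt h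
    rw [add_assoc, pow_add, IsometryEquiv.mul_apply, (g ^ k).dist_eq]
    exact hfar _ (by omega)
  have hinj : Function.Injective fun k : ℕ => (g ^ k) y := by
    intro k l hkl
    by_contra hne
    have h1 := hsep k l hne
    have h2 : (g ^ k) y = (g ^ l) y := hkl
    rw [h2, dist_self] at h1
    linarith
  have h := hN ((Finset.range (N + 1)).image fun k : ℕ => (g ^ k) y) ?_ ?_
  · rw [Finset.card_image_of_injective _ hinj, Finset.card_range] at h
    omega
  · intro z hz
    obtain ⟨k, hk, rfl⟩ := Finset.mem_image.1 (Finset.mem_coe.1 hz)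
    rw [Metric.mem_closedBall, dist_comm]
    exact hy k (by have := Finset.mem_range.1 hk; omega)
  · intro a ha b hb hab
    obtain ⟨k, _, rfl⟩ := Finset.mem_image.1 ha
    obtain ⟨l, _, rfl⟩ := Finset.mem_image.1 hb
    exact hsep k l fun hkl => hab (by rw [hkl])

/-- If `u` moves every point by more than a constant, then two points moved by at most `D` by `u`
are within `D` of each other, provided that neither can be brought closer to the other by
translating it by `u` or its inverse. -/
lemma IsGCB.dist_le_of_displacement (hσ : IsGCB σ) {δ D : ℝ}
    (hX : IsHyperbolic X δ) {u : X ≃ᵢ X} {x w : X}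
    (hx : dist x (u x) ≤ D) (hw : dist w (u w) ≤ D) (h1 : dist x w - 1 ≤ dist x (u w))
    (h2 : dist x w - 1 ≤ dist w (u x)) (hδ : 0 ≤ δ)
    (hlarge : ∀ y, 1 + 6 * δ < dist y (u y)) : dist x w ≤ D := by
  by_contra! hL
  have hhalf : (1 / 2 : ℝ) ∈ Icc (0 : ℝ) 1 := by constructor <;> norm_num
  set y := σ x w (1 / 2) with hy
  have hxy : dist x y = dist x w / 2 := by
    rw [hy, hσ.bicombing.dist_left x w hhalf]; ring
  have hyw : dist y w = dist x w - dist x w / 2 := by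
    rw [hy, hσ.bicombing.dist_right x w hhalf]; ring
  -- The two crossed distances have sum at most `2 * dist x w + 2 * δ`. Each is at least `dist x w -
  -- 1`, hence each is at most `dist x w + 1 + 2 * δ`.
  have h3 := hX.four_point x (u w) w (u x)
  rw [dist_comm (u w) (u x), u.dist_eq, dist_comm (u w) w] at h3
  have h4 : max (dist x w + dist x w) (dist x (u x) + dist w (u w)) ≤ 2 * dist x w :=
    max_le (by linarith) (by linarith)
  have h5 := hX.dist_geodesics_le (C := 1 + 2 * δ) (p' := u x) (q' := u w) rfl hxy hyw
    (u.dist_eq _ _) ((u.dist_eq _ _).trans hxy) ((u.dist_eq _ _).trans hyw)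
    (by linarith) (by linarith) (by linarith) (by linarith)
  linarith [hlarge y]

/-- The slack `1` avoids having to attain the infimum over the orbit. -/
lemma exists_zpow_dist_le (u : X ≃ᵢ X) (x w : X) :
    ∃ n : ℤ, ∀ m : ℤ, dist x ((u ^ n) w) - 1 ≤ dist x ((u ^ m) w) := by
  have hbdd : BddBelow (range fun n : ℤ => dist x ((u ^ n) w)) :=
    ⟨0, by rintro _ ⟨n, rfl⟩; exact dist_nonneg⟩
  obtain ⟨n, hn⟩ := exists_lt_of_ciInf_lt
    (lt_add_one (⨅ n : ℤ, dist x ((u ^ n) w)))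
  exact ⟨n, fun m => by linarith [ciInf_le hbdd m]⟩

/-- Powers of `g` commute, so moving `w` along the orbit of `g ^ a` preserves its displacement. -/
lemma dist_zpow_apply (g : X ≃ᵢ X) (a b : ℕ) (n : ℤ) (w : X) :
    dist (((g ^ a) ^ n) w) ((g ^ b) (((g ^ a) ^ n) w)) = dist w ((g ^ b) w) := by
  have hc : (g ^ b) * (g ^ a) ^ n = (g ^ a) ^ n * g ^ b :=
    (((Commute.refl g).pow_pow b a).zpow_right n).eq
  rw [← IsometryEquiv.mul_apply (g ^ b), hc, IsometryEquiv.mul_apply, IsometryEquiv.dist_eq]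

end Displacement

end MargulisDomain

namespace MargulisDomain

/-! ### The two cases -/

section Margulis

variable {X : Type*} [MetricSpace X] {σ : X → X → ℝ → X}

/-- The case of a power of small minimal displacement. -/
lemma IsGCB.exists_mem_of_minDisplacement_lt (hσ : IsGCB σ) {δ ε₁ ε₂ : ℝ} {N : ℕ} (hδ : 0 ≤ δ)
    (hε₁ : 0 ≤ ε₁) (hX : IsHyperbolic X δ)
    (hN : ∀ y : X, SeparatedCardLE ε₁ (Metric.closedBall y (1 + 4 * δ)) N) {g : X ≃ᵢ X} {i : ℕ} (hi : 0 < i) {x : X} (hx : dist x ((g ^ i) x) ≤ ε₂)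
    (hlt : minDisplacement (g ^ i) < 1 / (N + 1)) :
    ∃ y ∈ genMargulisDomain ε₁ g, dist x y ≤ N * ε₂ := by
  have : Nonempty X := ⟨x⟩
  obtain ⟨w, hw⟩ := exists_dist_lt_of_minDisplacement_lt hlt
  have hε₂ : 0 ≤ ε₂ := dist_nonneg.trans hx
  obtain ⟨y, hxy, hy⟩ := hσ.exists_dist_le_of_pow hδ hX (g := g ^ i) (N := N) (D := N * ε₂)
    (x := x) (w := w)
    (fun k hk => (dist_pow_apply_le _ _ _).trans (by gcongr))
    (fun k hk => by
      have hk' : (k : ℝ) ≤ N := by exact_mod_cast hk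
      calc _ ≤ k * dist w ((g ^ i) w) := dist_pow_apply_le _ _ _
        _ ≤ (N + 1) * (1 / (N + 1)) := by gcongr; linarith
        _ = 1 := by field_simp)
  obtain ⟨m, hm, hym⟩ := exists_dist_pow_le hε₁ (hN y) hy
  rw [← pow_mul] at hym
  exact ⟨y, mem_genMargulisDomain_of_pow (Nat.mul_pos hi hm) hym, hxy⟩

/-- A nonempty generalized Margulis domain contains almost minimal points, if the isometry has
positive minimal displacement. -/
lemma IsGCB.exists_almost_minimal (hσ : IsGCB σ) {ε : ℝ} {g : X ≃ᵢ X} (hg : IsSigmaIsometry σ g)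
    (hpos : 0 < minDisplacement g) (hne : (genMargulisDomain ε g).Nonempty) {η : ℝ}
    (hη : 0 < η) : ∃ w, dist w (g w) ≤ ε ∧ dist w (g w) ≤ minDisplacement g + η := by
  obtain ⟨w, hw⟩ := hne
  have : Nonempty X := ⟨w⟩
  rcases lt_or_ge (minDisplacement g) ε with hlt | hge
  · obtain ⟨v, hv⟩ := exists_dist_lt_of_minDisplacement_lt
      (lt_min hlt (lt_add_of_pos_right (minDisplacement g) hη))
    exact ⟨v, (hv.trans_le (min_le_left _ _)).le, (hv.trans_le (min_le_right _ _)).le⟩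
  · obtain ⟨j, hj, hwj⟩ := exists_pos_of_mem_genMargulisDomain hw
    have h1 := hσ.mul_minDisplacement_le hg j w
    -- Here `j * minDisplacement g ≤ ε ≤ minDisplacement g`, so `w` itself is moved at most `ε` by
    -- `g`.
    have h2 : (j : ℝ) ≤ 1 := by
      by_contra! h3
      nlinarith
    obtain rfl : j = 1 := by
      have : j ≤ 1 := by exact_mod_cast h2
      omega
    rw [pow_one] at hwj
    exact ⟨w, hwj, by linarith⟩

/-- The case of a power of large minimal displacement. -/
lemma IsGCB.exists_mem_of_le_minDisplacement (hσ : IsGCB σ) {δ ε₁ ε₂ c : ℝ} {k : ℕ} (hδ : 0 ≤ δ)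
    (hc : 0 < c) (hk : 1 + 6 * δ < k * c) (hX : IsHyperbolic X δ) {g : X ≃ᵢ X}
    (hg : IsSigmaIsometry σ g) (hne : (genMargulisDomain ε₁ g).Nonempty) {i : ℕ} (hi : 0 < i)
    {x : X} (hx : dist x ((g ^ i) x) ≤ ε₂) (hle : c ≤ minDisplacement (g ^ i)) :
    ∃ y ∈ genMargulisDomain ε₁ g, dist x y ≤ k * (ε₂ + 1) := by
  have : Nonempty X := ⟨x⟩
  have hi' : (0 : ℝ) < i := by exact_mod_cast hi
  have hpos : 0 < minDisplacement g := by
    by_contra! hnonpos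
    obtain ⟨v, hv⟩ := exists_dist_lt_of_minDisplacement_lt
      (hnonpos.trans_lt (by positivity : 0 < c / i))
    have h1 := (minDisplacement_le (g ^ i) v).trans (dist_pow_apply_le g v i)
    have h2 : i * dist v (g v) < i * (c / i) := by gcongr
    rw [mul_div_cancel₀ _ hi'.ne'] at h2
    linarith
  -- The excess `1 / i` becomes `1` after `i` iterations, whatever `i` is.
  obtain ⟨w₀, hw₀, hw₀'⟩ := hσ.exists_almost_minimal hg hpos hne (by positivity : 0 < 1 / (i : ℝ))
  have hw₀i : dist w₀ ((g ^ i) w₀) ≤ ε₂ + 1 := by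
    have h1 := (hσ.mul_minDisplacement_le hg i x).trans hx
    calc _ ≤ i * dist w₀ (g w₀) := dist_pow_apply_le _ _ _
      _ ≤ i * (minDisplacement g + 1 / i) := by gcongr
      _ = i * minDisplacement g + 1 := by field_simp
      _ ≤ _ := by linarith
  set u := g ^ (i * k) with hu
  obtain ⟨n, hn⟩ := exists_zpow_dist_le u x w₀
  set w := (u ^ n) w₀ with hw
  have hwg : dist w (g w) ≤ ε₁ := by
    have h1 := dist_zpow_apply g (i * k) 1 n w₀
    rw [pow_one] at h1
    exact h1.trans_le hw₀
  refine ⟨w, mem_genMargulisDomain_of_pow one_pos (by rwa [pow_one]), ?_⟩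
  have huk : u = (g ^ i) ^ k := by rw [hu, pow_mul]
  refine hσ.dist_le_of_displacement (u := u) hX ?_ ?_ ?_ ?_ hδ fun y => ?_
  · rw [huk]
    refine (dist_pow_apply_le _ _ _).trans ?_
    gcongr
    linarith
  · rw [hw, dist_zpow_apply, ← hu, huk]
    exact (dist_pow_apply_le _ _ _).trans (by gcongr)
  -- Almost minimality of `n` against its two neighbours says that neither `u` nor its inverse
  -- brings `w` much closer to `x`.
  · have h1 := hn (1 + n)
    rwa [zpow_add, zpow_one, IsometryEquiv.mul_apply] at h1
  · have h1 := hn (-1 + n)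
    rw [zpow_add, zpow_neg_one, IsometryEquiv.mul_apply, ← u.dist_eq x (u⁻¹ _),
      IsometryEquiv.apply_inv_self] at h1
    rwa [dist_comm w]
  · have h1 := hσ.mul_minDisplacement_le (hg.pow i) k y
    rw [← huk] at h1
    have h2 : k * c ≤ k * minDisplacement (g ^ i) := by gcongr
    linarith

end Margulis

end MargulisDomain

theorem mainTheorem9 (P₀ r₀ δ ε₁ ε₂ : ℝ) (hr₀ : 0 < r₀) (hδ : 0 ≤ δ)
    (hε₁ : 0 < ε₁) (hε : ε₁ ≤ ε₂) :
    ∃ K₀ : ℝ, ∀ (X : Type*) [MetricSpace X] [CompleteSpace X] (σ : X → X → ℝ → X),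
      MargulisDomain.IsGCB σ → MargulisDomain.IsHyperbolic X δ →
      MargulisDomain.IsPacked X P₀ r₀ →
      ∀ g : X ≃ᵢ X, MargulisDomain.IsSigmaIsometry σ g → ¬ MargulisDomain.IsElliptic g →
        (MargulisDomain.genMargulisDomain ε₁ g).Nonempty →
        ∀ x ∈ MargulisDomain.genMargulisDomain ε₂ g,
          Metric.infDist x (MargulisDomain.genMargulisDomain ε₁ g) ≤ K₀ := by
  obtain ⟨N, hN⟩ := MargulisDomain.exists_separatedCardLE P₀ r₀ ε₁ (1 + 4 * δ) hr₀ hε₁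
  have hc : (0 : ℝ) < 1 / (N + 1) := by positivity
  obtain ⟨k, hk⟩ := exists_nat_gt ((1 + 6 * δ) / (1 / ((N : ℝ) + 1)))
  rw [div_lt_iff₀ hc] at hk
  refine ⟨max (N * ε₂) (k * (ε₂ + 1)), fun X _ _ σ hσ hX hpack g hg _ hne x hx => ?_⟩
  obtain ⟨i, hi, hxi⟩ := MargulisDomain.exists_pos_of_mem_genMargulisDomain hx
  rcases lt_or_ge (MargulisDomain.minDisplacement (g ^ i)) (1 / (N + 1)) with hlt | hge
  · obtain ⟨y, hy, hxy⟩ := hσ.exists_mem_of_minDisplacement_lt hδ hε₁.le hX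
      (hN X σ hσ hpack) hi hxi hlt
    exact (Metric.infDist_le_dist_of_mem hy).trans (hxy.trans (le_max_left _ _))
  · obtain ⟨y, hy, hxy⟩ := hσ.exists_mem_of_le_minDisplacement hδ hc hk hX hg hne hi hxi hge
    exact (Metric.infDist_le_dist_of_mem hy).trans (hxy.trans (le_max_right _ _))
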